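/- **Partial-computing red-blue pebble game (PRBP).** Let $G=(V,E)$ be a finite DAG and $r\ge 1$ an integer (the fast memory capacity). In every state of the game each node carries no pebble, or a blue pebble, or a blue and a light red pebble, or only a dark red pebble, and each edge is either marked or unmarked. Initially exactly the sources carry a blue pebble, there are no other pebbles, and no edge is marked. The moves are: (1) *save*: replace a dark red pebble on a node $v$ by a blue and a light red pebble; (2) *load*: place a light red pebble on a node $v$ that has a blue pebble; (3) *partial compute*: for an unmarked edge $(u,v)$ such that all incoming edges of $u$ are marked, $u$ has a (light or dark) red pebble, and $v$ has either a (light or dark) red pebble or no pebble at all, replace all pebbles on $v$ by a dark red pebble and mark $(u,v)$; (4) *delete*: remove a light red pebble from a node $v$, or remove a dark red pebble from a node $v$ all of whose incoming and outgoing edges are marked. A pebbling strategy is a finite sequence of moves from the initial state, with at most $r$ (light and dark) red pebbles on $G$ at any time, to a state in which every edge is marked and every sink has a blue pebble. Its cost is its number of save and load moves, and $\mathrm{OPT}_{PRBP}(G,r)$ is the minimum cost of a pebbling strategy ($+\infty$ if there is none). **Matrix multiplication DAG.** For integers $m_1,m_2,m_3\ge 1$, let $G_{m_1,m_2,m_3}$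 be the DAG of the standard multiplication of an $m_1\times m_2$ matrix $A$ by an $m_2\times m_3$ matrix $B$. Its nodes are the sources $A_{i,k}$ and $B_{k,j}$, the internal nodes $P_{i,k,j}$, and the sinks $C_{i,j}$ ($1\le i\le m_1$, $1\le k\le m_2$, $1\le j\le m_3$), and its edges are $A_{i,k}\to P_{i,k,j}$, $B_{k,j}\to P_{i,k,j}$ and $P_{i,k,j}\to C_{i,j}$ for all $i,k,j$. **Theorem.** $\mathrm{OPT}_{PRBP}(G_{m_1,m_2,m_3},r)=\Omega\left(\frac{m_1 m_2 m_3}{\sqrt r}\right)$; that is, there is an absolute constant $c>0$ such that for all integers $m_1,m_2,m_3\ge 1$ and $r\ge 1$, $$\mathrm{OPT}_{PRBP}(G_{m_1,m_2,m_3},r)\ \ge\ c\cdot\frac{m_1 m_2 m_3}{\sqrt r}.$$ -/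

import Mathlib

/-- A directed acyclic graph on the node set `V`. -/
structure DAG (V : Type*) where
  /-- `Edge u v` means that there is a directed edge from `u` to `v`. -/
  Edge : V → V → Prop
  acyclic : ∀ v, ¬ Relation.TransGen Edge v v

namespace DAG

/-- A source: a node without incoming edges. -/
def IsSource {V : Type*} (G : DAG V) (v : V) : Prop := ∀ u, ¬ G.Edge u v

/-- A sink: a node without outgoing edges. -/
def IsSink {V : Type*} (G : DAG V) (v : V) : Prop := ∀ w, ¬ G.Edge v w

end DAG

namespace PRBP

/-- The four possible sets of pebbles on a node in the partial-computing red-blue pebble game. -/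
inductive Pebbles where
  /-- no pebble -/
  | empty
  /-- a blue pebble only -/
  | blue
  /-- a blue and a light red pebble -/
  | blueLight
  /-- a dark red pebble only -/
  | dark

/-- There is a (light or dark) red pebble. -/
def Pebbles.HasRed (p : Pebbles) : Prop := p = .blueLight ∨ p = .dark

/-- There is a blue pebble. -/
def Pebbles.HasBlue (p : Pebbles) : Prop := p = .blue ∨ p = .blueLight

/-- A state of the game: the pebbles on each node and the set of marked edges. -/
structure Config (V : Type*) where
  pebbles : V → Pebbles
  marked : Set (V × V)

/-- The moves of the game. -/
inductive Move (V : Type*) where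
  | save (v : V)
  | load (v : V)
  /-- partial compute along the edge `(u, v)` -/
  | compute (u v : V)
  | delete (v : V)

/-- Save and load operations cost `1`, partial compute and delete operations are free. -/
def Move.cost {V : Type*} : Move V → ℕ
  | .save _ => 1
  | .load _ => 1
  | .compute _ _ => 0
  | .delete _ => 0

/-- All incoming edges of `v` are marked. -/
def Config.InMarked {V : Type*} (c : Config V) (G : DAG V) (v : V) : Prop :=
  ∀ u, G.Edge u v → (u, v) ∈ c.marked

/-- All outgoing edges of `v` are marked. -/
def Config.OutMarked {V : Type*} (c : Config V) (G : DAG V) (v : V) : Prop :=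
  ∀ w, G.Edge v w → (v, w) ∈ c.marked

/-- The number of (light and dark) red pebbles on the DAG. -/
noncomputable def Config.redCount {V : Type*} (c : Config V) : ℕ∞ :=
  {v | (c.pebbles v).HasRed}.encard

open Classical in
/-- The state in which the pebbles on `v` have been replaced by `p`. -/
noncomputable def Config.setPebbles {V : Type*} (c : Config V) (v : V) (p : Pebbles) :
    Config V where
  pebbles := Function.update c.pebbles v p
  marked := c.marked

/-- The transition rules: `Step G c m c'` says that the move `m` is allowed in the state `c` and
leads to the state `c'` (the memory capacity is not part of this relation).

A dark red pebble may be deleted from `v` only if the value of `v` is fully computed and is not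
needed as an input any more. For a node that has outgoing edges the first condition follows from
the second one in every reachable state; for a sink it rules out that a partially computed value
is thrown away and the computation is continued afterwards. -/
inductive Step {V : Type*} (G : DAG V) : Config V → Move V → Config V → Prop where
  | save (c : Config V) (v : V) (h : c.pebbles v = .dark) :
      Step G c (.save v) (c.setPebbles v .blueLight)
  | load (c : Config V) (v : V) (h : (c.pebbles v).HasBlue) :
      Step G c (.load v) (c.setPebbles v .blueLight)
  | compute (c : Config V) (u v : V) (hedge : G.Edge u v) (hunmarked : (u, v) ∉ c.marked)
      (hin : c.InMarked G u) (hu : (c.pebbles u).HasRed)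
      (hv : (c.pebbles v).HasRed ∨ c.pebbles v = .empty) :
      Step G c (.compute u v)
        { pebbles := (c.setPebbles v .dark).pebbles, marked := insert (u, v) c.marked }
  | deleteLight (c : Config V) (v : V) (h : c.pebbles v = .blueLight) :
      Step G c (.delete v) (c.setPebbles v .blue)
  | deleteDark (c : Config V) (v : V) (h : c.pebbles v = .dark)
      (hin : c.InMarked G v) (hout : c.OutMarked G v) :
      Step G c (.delete v) (c.setPebbles v .empty)

open Classical in
/-- The initial state: blue pebbles on exactly the sources, no marked edges. -/
noncomputable def initial {V : Type*} (G : DAG V) : Config V where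
  pebbles := fun v => if G.IsSource v then .blue else .empty
  marked := ∅

/-- A terminal state: every sink has a blue pebble and every edge is marked. -/
def IsTerminal {V : Type*} (G : DAG V) (c : Config V) : Prop :=
  (∀ v, G.IsSink v → (c.pebbles v).HasBlue) ∧ ∀ u v, G.Edge u v → (u, v) ∈ c.marked

/-- A (one-shot) pebbling strategy with at most `r` red pebbles: `length` moves, the `t`-th of
which leads from the state `config t` to `config (t + 1)`. The values of `config` beyond `length`
and of `move` from `length` on are irrelevant. -/
structure Pebbling {V : Type*} (G : DAG V) (r : ℕ) where
  length : ℕ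
  config : ℕ → Config V
  move : ℕ → Move V
  start : config 0 = initial G
  step : ∀ t < length, Step G (config t) (move t) (config (t + 1))
  capacity : ∀ t ≤ length, (config t).redCount ≤ r
  terminal : IsTerminal G (config length)

/-- The cost of a pebbling strategy: its number of save and load operations. -/
def Pebbling.cost {V : Type*} {G : DAG V} {r : ℕ} (P : Pebbling G r) : ℕ :=
  ∑ t ∈ Finset.range P.length, (P.move t).cost

/-- The optimal cost of a pebbling strategy with at most `r` red pebbles
(`⊤` if there is no such strategy). -/
noncomputable def OPT {V : Type*} (G : DAG V) (r : ℕ) : ℕ∞ :=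
  ⨅ P : Pebbling G r, (P.cost : ℕ∞)

end PRBP

/-- The nodes of the DAG of standard matrix multiplication `C = A * B`, where `A` has size
`m₁ × m₂` and `B` has size `m₂ × m₃`. -/
inductive MatMulNode (m₁ m₂ m₃ : ℕ) where
  /-- the input `A i k` -/
  | left (i : Fin m₁) (k : Fin m₂)
  /-- the input `B k j` -/
  | right (k : Fin m₂) (j : Fin m₃)
  /-- the product `A i k * B k j` -/
  | prod (i : Fin m₁) (k : Fin m₂) (j : Fin m₃)
  /-- the output `C i j`, the sum of the products `A i k * B k j` over all `k` -/
  | out (i : Fin m₁) (j : Fin m₃)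

/-- The edges of the matrix multiplication DAG. -/
inductive MatMulEdge (m₁ m₂ m₃ : ℕ) : MatMulNode m₁ m₂ m₃ → MatMulNode m₁ m₂ m₃ → Prop where
  | left (i : Fin m₁) (k : Fin m₂) (j : Fin m₃) : MatMulEdge m₁ m₂ m₃ (.left i k) (.prod i k j)
  | right (i : Fin m₁) (k : Fin m₂) (j : Fin m₃) : MatMulEdge m₁ m₂ m₃ (.right k j) (.prod i k j)
  | out (i : Fin m₁) (k : Fin m₂) (j : Fin m₃) : MatMulEdge m₁ m₂ m₃ (.prod i k j) (.out i j)

/-- The layer of a node; it witnesses acyclicity. -/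
def MatMulNode.layer {m₁ m₂ m₃ : ℕ} : MatMulNode m₁ m₂ m₃ → ℕ
  | .left _ _ => 0
  | .right _ _ => 0
  | .prod _ _ _ => 1
  | .out _ _ => 2

theorem MatMulEdge.layer_lt {m₁ m₂ m₃ : ℕ} {u v : MatMulNode m₁ m₂ m₃}
    (h : MatMulEdge m₁ m₂ m₃ u v) : u.layer < v.layer := by
  cases h <;> simp [MatMulNode.layer]

theorem MatMulEdge.layer_lt_of_transGen {m₁ m₂ m₃ : ℕ} {u v : MatMulNode m₁ m₂ m₃}
    (h : Relation.TransGen (MatMulEdge m₁ m₂ m₃) u v) : u.layer < v.layer := by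
  induction h with
  | single h => exact h.layer_lt
  | tail _ h ih => exact ih.trans h.layer_lt

/-- The DAG of standard matrix multiplication of an `m₁ × m₂` matrix by an `m₂ × m₃` matrix. -/
def matMulDAG (m₁ m₂ m₃ : ℕ) : DAG (MatMulNode m₁ m₂ m₃) where
  Edge := MatMulEdge m₁ m₂ m₃
  acyclic := fun _ h => lt_irrefl _ (MatMulEdge.layer_lt_of_transGen h)

/-!
Cut a strategy into intervals of cost `r`, counted from the end, and consider the products that are
added to an output within one interval. The output is red at the end of the interval or transferred,
since a sink that has become dark red can only be given up by saving it. The product itself is red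
at the start, or transferred, or it is computed within the interval, in which case its two factors
are red at the start or transferred. Each of these sets has at most `2 r` nodes, so by the
Loomis–Whitney inequality `O(r √r)` of the `m₁ m₂ m₃` products are added per interval.
-/

theorem exists_not_and_succ_of_le {p : ℕ → Prop} {s t : ℕ} (hst : s ≤ t) (hs : ¬ p s) (ht : p t) :
    ∃ u, s ≤ u ∧ u < t ∧ ¬ p u ∧ p (u + 1) := by
  by_contra! h
  exact Nat.le_induction (P := fun u _ => u ≤ t → ¬ p u) (fun _ => hs)
    (fun u hsu ih hut => h u hsu hut (ih (by lia))) t hst le_rfl ht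

section Cardinality

open Finset

variable {α β γ : Type*}

theorem card_le_of_injective_of_mem {X : Finset α} {f : α → β}
    (hf : Function.Injective f) {S : Set β} (hX : ∀ a ∈ X, f a ∈ S) {n : ℕ} (hS : S.encard ≤ n) :
    #X ≤ n := by
  have hmaps : Set.MapsTo f X S := hX
  have h := (Set.encard_le_encard_of_injOn hmaps hf.injOn).trans hS
  rw [Set.encard_coe_eq_coe_finsetCard] at h
  exact_mod_cast h

variable [DecidableEq β]

theorem card_sq_le_card_image_mul_card_collisions (X : Finset α) (f : α → β) :
    #X ^ 2 ≤ #(X.image f) * #{p ∈ X ×ˢ X | f p.1 = f p.2} := by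
  have hcollisions : #{p ∈ X ×ˢ X | f p.1 = f p.2} = ∑ b ∈ X.image f, #{a ∈ X | f a = b} ^ 2 := by
    rw [card_eq_sum_card_fiberwise (f := fun p => f p.1) (t := X.image f)]
    · refine sum_congr rfl fun b _ => ?_
      rw [sq, ← card_product]
      congr 1
      grind
    · intro p hp
      simp only [coe_filter, mem_product, Set.mem_ofPred_eq] at hp
      exact mem_image_of_mem f hp.1.1
  rw [hcollisions, card_eq_sum_card_image f X]
  exact sq_sum_le_card_mul_sum_sq

theorem card_sq_le_card_projections [DecidableEq α] [DecidableEq γ] (X : Finset (α × β × γ)) :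
    #X ^ 2 ≤ #(X.image fun p => (p.1, p.2.1)) * #(X.image fun p => (p.2.1, p.2.2)) *
      #(X.image fun p => (p.1, p.2.2)) := by
  rw [mul_comm, ← card_product]
  refine (card_sq_le_card_image_mul_card_collisions X fun p => (p.1, p.2.2)).trans
    (Nat.mul_le_mul_left _ ?_)
  -- Two triples `(a, b, c)` and `(a, b', c)` are determined by `(a, b)` and `(b', c)`.
  refine card_le_card_of_injOn (fun pq => ((pq.1.1, pq.1.2.1), (pq.2.2.1, pq.2.2.2))) ?_ ?_
  · rintro ⟨p, q⟩ hpq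
    simp only [coe_filter, mem_product, Set.mem_ofPred_eq] at hpq
    exact mem_product.2 ⟨mem_image_of_mem _ hpq.1.1, mem_image_of_mem _ hpq.1.2⟩
  · rintro ⟨⟨a, b, c⟩, a', b', c'⟩ h ⟨⟨x, y, z⟩, x', y', z'⟩ h' heq
    simp only [coe_filter, mem_product, Set.mem_ofPred_eq, Prod.mk.injEq] at h h' heq ⊢
    grind

end Cardinality

namespace PRBP

variable {V : Type*} {G : DAG V}

theorem Config.pebbles_setPebbles_self (c : Config V) (v : V) (p : Pebbles) :
    (c.setPebbles v p).pebbles v = p := by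
  simp [setPebbles]

theorem Config.pebbles_setPebbles_of_ne (c : Config V) {v w : V} (p : Pebbles) (h : w ≠ v) :
    (c.setPebbles v p).pebbles w = c.pebbles w := by
  simp [setPebbles, h]

namespace Step

variable {c c' : Config V} {m : Move V} {u v : V}

theorem marked_subset (h : Step G c m c') : c.marked ⊆ c'.marked := by
  cases h with
  | compute => exact Set.subset_insert _ _
  | _ => exact subset_rfl

theorem of_marked (h : Step G c m c') (hc : (u, v) ∉ c.marked) (hc' : (u, v) ∈ c'.marked) :
    G.Edge u v ∧ c.InMarked G u ∧ (c.pebbles u).HasRed ∧ c'.pebbles v = .dark := by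
  cases h with
  | compute x y hedge _ hin hred =>
    obtain ⟨rfl, rfl⟩ : u = x ∧ v = y := Prod.ext_iff.1 (hc'.resolve_right hc)
    exact ⟨hedge, hin, hred, c.pebbles_setPebbles_self v .dark⟩
  | _ => exact absurd hc' hc

theorem inMarked_outMarked_of_becomes_empty (h : Step G c m c') (hv : c.pebbles v ≠ .empty)
    (hv' : c'.pebbles v = .empty) : c.InMarked G v ∧ c.OutMarked G v := by
  cases h <;> grind [Config.pebbles_setPebbles_self, Config.pebbles_setPebbles_of_ne]

theorem exists_unmarked_edge_of_becomes_nonempty (h : Step G c m c') (hv : c.pebbles v = .empty)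
    (hv' : c'.pebbles v ≠ .empty) : ∃ u, G.Edge u v ∧ (u, v) ∉ c.marked := by
  cases h <;>
    grind [Config.pebbles_setPebbles_self, Config.pebbles_setPebbles_of_ne, Pebbles.HasBlue]

theorem eq_load_or_empty_of_becomes_hasRed (h : Step G c m c') (hv : ¬ (c.pebbles v).HasRed)
    (hv' : (c'.pebbles v).HasRed) :
    m = .load v ∨ c.pebbles v = .empty ∧ c'.pebbles v ≠ .empty := by
  cases h <;>
    grind [Config.pebbles_setPebbles_self, Config.pebbles_setPebbles_of_ne, Pebbles.HasRed]

theorem eq_save_or_empty_of_loses_dark (h : Step G c m c') (hv : c.pebbles v = .dark)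
    (hv' : c'.pebbles v ≠ .dark) : m = .save v ∨ c'.pebbles v = .empty := by
  cases h <;>
    grind [Config.pebbles_setPebbles_self, Config.pebbles_setPebbles_of_ne, Pebbles.HasBlue]

end Step

/-- The node that a move transfers between slow and fast memory, if any. -/
def Move.transferred : Move V → Finset V
  | .save v => {v}
  | .load v => {v}
  | .compute _ _ => ∅
  | .delete _ => ∅

theorem Move.card_transferred (m : Move V) : m.transferred.card = m.cost := by
  cases m <;> rfl

theorem Move.cost_le_one (m : Move V) : m.cost ≤ 1 := by
  cases m <;> simp [cost]

namespace Pebbling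

variable {r : ℕ} (P : Pebbling G r)

/-- The cost of the first `t` moves. -/
def costUpTo (t : ℕ) : ℕ := ∑ u ∈ Finset.range t, (P.move u).cost

open Classical in
/-- The nodes that are saved or loaded by the moves `s, …, t - 1`. -/
noncomputable def transferred (s t : ℕ) : Finset V :=
  (Finset.Ico s t).biUnion fun u => (P.move u).transferred

/-- The nodes whose values the moves `s, …, t - 1` may use without computing them: the red nodes of
the state `s` and the transferred nodes. -/
def inputs (s t : ℕ) : Set V := {v | ((P.config s).pebbles v).HasRed} ∪ P.transferred s t

/-- The nodes whose values the moves `s, …, t - 1` may pass on: the red nodes of the state `t` and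
the transferred nodes. -/
def outputs (s t : ℕ) : Set V := {v | ((P.config t).pebbles v).HasRed} ∪ P.transferred s t

variable {s t u : ℕ} {v x z : V}

theorem costUpTo_add_card_transferred_le (hst : s ≤ t) :
    P.costUpTo s + (P.transferred s t).card ≤ P.costUpTo t := by
  classical
  calc P.costUpTo s + (P.transferred s t).card
    _ ≤ P.costUpTo s + ∑ u ∈ Finset.Ico s t, (P.move u).cost := by
        gcongr
        simpa only [Move.card_transferred, transferred] using
          Finset.card_biUnion_le (s := Finset.Ico s t) (t := fun u => (P.move u).transferred)
    _ = P.costUpTo t := Finset.sum_range_add_sum_Ico _ hst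

theorem costUpTo_length : P.costUpTo P.length = P.cost := rfl

theorem exists_costUpTo_eq {n : ℕ} (hn : n ≤ P.costUpTo t) : ∃ s ≤ t, P.costUpTo s = n := by
  obtain rfl | hpos := n.eq_zero_or_pos
  · exact ⟨0, t.zero_le, rfl⟩
  · have hzero : ¬ n ≤ P.costUpTo 0 := by simp [costUpTo, hpos.ne']
    obtain ⟨u, -, hut, hlt, hle⟩ := 
      exists_not_and_succ_of_le (p := fun u => n ≤ P.costUpTo u) t.zero_le hzero hn
    have hsucc : P.costUpTo (u + 1) = P.costUpTo u + (P.move u).cost := Finset.sum_range_succ _ _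
    have := (P.move u).cost_le_one
    exact ⟨u + 1, hut, by lia⟩

theorem encard_union_transferred_le {c : Config V} {a n : ℕ} (hst : s ≤ t) (ha : c.redCount ≤ a)
    (hn : P.costUpTo t ≤ P.costUpTo s + n) :
    ({v | (c.pebbles v).HasRed} ∪ P.transferred s t : Set V).encard ≤ (a + n : ℕ) := by
  have hcard : (P.transferred s t).card ≤ n := by
    have := P.costUpTo_add_card_transferred_le hst
    lia
  refine (Set.encard_union_le _ _).trans ?_
  rw [Set.encard_coe_eq_coe_finsetCard, Nat.cast_add]
  exact add_le_add ha (Nat.cast_le.2 hcard)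

theorem redCount_zero : (P.config 0).redCount = 0 := by
  rw [Config.redCount, Set.encard_eq_zero, Set.eq_empty_iff_forall_notMem, P.start]
  intro v
  by_cases h : G.IsSource v <;> simp [initial, h, Pebbles.HasRed]

theorem mem_transferred_of_mem (hsu : s ≤ u) (hut : u < t) (hv : v ∈ (P.move u).transferred) :
    v ∈ P.transferred s t := by
  classical exact Finset.mem_biUnion.2 ⟨u, Finset.mem_Ico.2 ⟨hsu, hut⟩, hv⟩

theorem marked_subset (hst : s ≤ t) (ht : t ≤ P.length) :
    (P.config s).marked ⊆ (P.config t).marked := by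
  induction t, hst using Nat.le_induction with
  | base => exact subset_rfl
  | succ t _ ih => exact (ih (by lia)).trans (P.step t ht).marked_subset

theorem exists_compute (hst : s ≤ t) (ht : t ≤ P.length) (hs : (x, v) ∉ (P.config s).marked)
    (hmarked : (x, v) ∈ (P.config t).marked) :
    ∃ u, s ≤ u ∧ u < t ∧ (x, v) ∉ (P.config u).marked ∧ G.Edge x v ∧ (P.config u).InMarked G x ∧
      ((P.config u).pebbles x).HasRed ∧ (P.config (u + 1)).pebbles v = .dark := by
  obtain ⟨u, hsu, hut, hu, hu'⟩ :=
    exists_not_and_succ_of_le (p := fun u => (x, v) ∈ (P.config u).marked) hst hs hmarked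
  exact ⟨u, hsu, hut, hu, (P.step u (by lia)).of_marked hu hu'⟩

theorem inMarked_outMarked_of_becomes_empty (hst : s ≤ t) (ht : t ≤ P.length)
    (hs : (P.config s).pebbles v ≠ .empty) (hempty : (P.config t).pebbles v = .empty) :
    (P.config t).InMarked G v ∧ (P.config t).OutMarked G v := by
  obtain ⟨u, -, hut, hu, hu'⟩ :=
    exists_not_and_succ_of_le (p := fun u => (P.config u).pebbles v = .empty) hst hs hempty
  obtain ⟨hin, hout⟩ := (P.step u (by lia)).inMarked_outMarked_of_becomes_empty hu hu'
  have hsub := P.marked_subset hut.le ht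
  exact ⟨fun w hw => hsub (hin w hw), fun w hw => hsub (hout w hw)⟩

theorem outMarked_of_marked_of_empty (ht : t ≤ P.length) (hmarked : (x, v) ∈ (P.config t).marked)
    (hempty : (P.config t).pebbles v = .empty) : (P.config t).OutMarked G v := by
  have hzero : (x, v) ∉ (P.config 0).marked := by simp [P.start, initial]
  obtain ⟨u, -, hut, -, -, -, -, hdark⟩ := P.exists_compute t.zero_le ht hzero hmarked
  exact (P.inMarked_outMarked_of_becomes_empty hut ht (by simp [hdark]) hempty).2

/-- Once deleted, a node cannot be computed again, and the terminal state needs the sinks. -/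
theorem ne_empty_of_isSink (hv : G.IsSink v) (hst : s ≤ t) (ht : t ≤ P.length)
    (hs : (P.config s).pebbles v ≠ .empty) : (P.config t).pebbles v ≠ .empty := by
  intro hempty
  have hfinal : (P.config P.length).pebbles v ≠ .empty := by
    rcases P.terminal.1 v hv with h | h <;> simp [h]
  have hin := (P.inMarked_outMarked_of_becomes_empty hst ht hs hempty).1
  obtain ⟨u, htu, hu, hempty', hne⟩ := exists_not_and_succ_of_le
    (p := fun u => (P.config u).pebbles v ≠ .empty) ht (not_not.2 hempty) hfinal
  obtain ⟨x, hx, hunmarked⟩ :=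
    (P.step u hu).exists_unmarked_edge_of_becomes_nonempty (not_not.1 hempty') hne
  exact hunmarked (P.marked_subset htu hu.le (hin x hx))

theorem mem_outputs_of_isSink (hv : G.IsSink v) (hsu : s ≤ u) (hut : u ≤ t) (ht : t ≤ P.length)
    (hdark : (P.config u).pebbles v = .dark) : v ∈ P.outputs s t := by
  by_cases hfinal : (P.config t).pebbles v = .dark
  · exact .inl (.inr hfinal)
  · obtain ⟨w, huw, hwt, hw, hw'⟩ := exists_not_and_succ_of_le
      (p := fun w => (P.config w).pebbles v ≠ .dark) hut (not_not.2 hdark) hfinal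
    rcases (P.step w (by lia)).eq_save_or_empty_of_loses_dark (not_not.1 hw) hw' with h | h
    · exact .inr (P.mem_transferred_of_mem (hsu.trans huw) hwt (by simp [h, Move.transferred]))
    · exact absurd h (P.ne_empty_of_isSink hv (by lia : u ≤ w + 1) (by lia) (by simp [hdark]))

theorem mem_inputs_or_exists_empty (hsu : s ≤ u) (hut : u ≤ t) (hu : u ≤ P.length)
    (hred : ((P.config u).pebbles v).HasRed) :
    v ∈ P.inputs s t ∨ ∃ w, s ≤ w ∧ w < u ∧ (P.config w).pebbles v = .empty ∧
      (P.config (w + 1)).pebbles v ≠ .empty := by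
  by_cases hs : ((P.config s).pebbles v).HasRed
  · exact .inl (.inl hs)
  · obtain ⟨w, hsw, hwu, hw, hw'⟩ :=
      exists_not_and_succ_of_le (p := fun w => ((P.config w).pebbles v).HasRed) hsu hs hred
    rcases (P.step w (by lia)).eq_load_or_empty_of_becomes_hasRed hw hw' with h | h
    · exact .inl (.inr (P.mem_transferred_of_mem hsw (by lia) (by simp [h, Move.transferred])))
    · exact .inr ⟨w, hsw, hwu, h⟩

theorem mem_inputs_of_isSource (hv : G.IsSource v) (hsu : s ≤ u) (hut : u ≤ t) (hu : u ≤ P.length)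
    (hred : ((P.config u).pebbles v).HasRed) : v ∈ P.inputs s t := by
  refine (P.mem_inputs_or_exists_empty hsu hut hu hred).resolve_right ?_
  rintro ⟨w, -, hwu, hempty, hne⟩
  obtain ⟨x, hx, -⟩ := (P.step w (by lia)).exists_unmarked_edge_of_becomes_nonempty hempty hne
  exact hv x hx

theorem mem_inputs_or_source_mem_inputs (hst : s ≤ t) (ht : t ≤ P.length)
    (hs : (v, z) ∉ (P.config s).marked) (hmarked : (v, z) ∈ (P.config t).marked) :
    v ∈ P.inputs s t ∨ ∀ x, G.IsSource x → G.Edge x v → x ∈ P.inputs s t := by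
  obtain ⟨u, hsu, hut, hunmarked, hvz, hin, hred, -⟩ := P.exists_compute hst ht hs hmarked
  refine (P.mem_inputs_or_exists_empty hsu hut.le (by lia) hred).imp_right ?_
  rintro ⟨w, hsw, hwu, hempty, -⟩ x hsource hxv
  -- An empty node with an unmarked outgoing edge has no marked incoming edge: it was never deleted.
  have hxw : (x, v) ∉ (P.config w).marked := fun h => hunmarked <|
    P.marked_subset hwu.le (by lia) (P.outMarked_of_marked_of_empty (by lia) h hempty z hvz)
  obtain ⟨y, hwy, hyu, -, -, -, hxred, -⟩ := P.exists_compute hwu.le (by lia) hxw (hin x hxv)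
  exact P.mem_inputs_of_isSource hsource (hsw.trans hwy) (by lia) (by lia) hxred

theorem mem_outputs_of_marked (hz : G.IsSink z) (hst : s ≤ t) (ht : t ≤ P.length)
    (hs : (v, z) ∉ (P.config s).marked) (hmarked : (v, z) ∈ (P.config t).marked) :
    z ∈ P.outputs s t := by
  obtain ⟨u, hsu, hut, -, -, -, -, hdark⟩ := P.exists_compute hst ht hs hmarked
  exact P.mem_outputs_of_isSink hz (by lia) hut ht hdark

end Pebbling

end PRBP

section MatMul

open Finset

variable {m₁ m₂ m₃ : ℕ}

theorem card_triples_le_mul_sqrt {X : Finset (Fin m₁ × Fin m₂ × Fin m₃)}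
    {I O : Set (MatMulNode m₁ m₂ m₃)} {n k : ℕ} (hI : I.encard ≤ n) (hO : O.encard ≤ k)
    (hleft : ∀ p ∈ X, .left p.1 p.2.1 ∈ I) (hright : ∀ p ∈ X, .right p.2.1 p.2.2 ∈ I)
    (hout : ∀ p ∈ X, .out p.1 p.2.2 ∈ O) : (#X : ℝ) ≤ n * √k := by
  have hA : #(X.image fun p => (p.1, p.2.1)) ≤ n :=
    card_le_of_injective_of_mem (f := fun p => MatMulNode.left p.1 p.2) (fun p q h => by grind)
      (forall_mem_image.2 hleft) hI
  have hB : #(X.image fun p => (p.2.1, p.2.2)) ≤ n :=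
    card_le_of_injective_of_mem (f := fun p => MatMulNode.right p.1 p.2) (fun p q h => by grind)
      (forall_mem_image.2 hright) hI
  have hC : #(X.image fun p => (p.1, p.2.2)) ≤ k :=
    card_le_of_injective_of_mem (f := fun p => MatMulNode.out p.1 p.2) (fun p q h => by grind)
      (forall_mem_image.2 hout) hO
  have hsq : (#X : ℝ) ^ 2 ≤ n ^ 2 * k := by
    exact_mod_cast (card_sq_le_card_projections X).trans
      ((Nat.mul_le_mul (Nat.mul_le_mul hA hB) hC).trans_eq (by ring))
  calc (#X : ℝ)
    _ ≤ √(n ^ 2 * k) := Real.le_sqrt_of_sq_le hsq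
    _ = n * √k := by rw [Real.sqrt_mul (by positivity), Real.sqrt_sq (by positivity)]

theorem card_triples_le_mul_one_add_sqrt {X : Finset (Fin m₁ × Fin m₂ × Fin m₃)}
    {I O : Set (MatMulNode m₁ m₂ m₃)} {n k : ℕ} (hI : I.encard ≤ n) (hO : O.encard ≤ k)
    (hin : ∀ p ∈ X, .prod p.1 p.2.1 p.2.2 ∈ I ∨ .left p.1 p.2.1 ∈ I ∧ .right p.2.1 p.2.2 ∈ I)
    (hout : ∀ p ∈ X, .out p.1 p.2.2 ∈ O) : (#X : ℝ) ≤ n * (1 + √k) := by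
  classical
  have hprod : #{p ∈ X | .prod p.1 p.2.1 p.2.2 ∈ I} ≤ n :=
    card_le_of_injective_of_mem
      (f := fun p : Fin m₁ × Fin m₂ × Fin m₃ => MatMulNode.prod p.1 p.2.1 p.2.2)
      (fun p q h => by grind) (fun p hp => (mem_filter.1 hp).2) hI
  have hinputs : (#{p ∈ X | .prod p.1 p.2.1 p.2.2 ∉ I} : ℝ) ≤ n * √k :=
    card_triples_le_mul_sqrt hI hO (by grind) (by grind) (by grind)
  calc (#X : ℝ)
    _ = #{p ∈ X | .prod p.1 p.2.1 p.2.2 ∈ I} + #{p ∈ X | .prod p.1 p.2.1 p.2.2 ∉ I} := by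
        exact_mod_cast (card_filter_add_card_filter_not _).symm
    _ ≤ n + n * √k := add_le_add (by exact_mod_cast hprod) hinputs
    _ = n * (1 + √k) := by ring

end MatMul

namespace PRBP.Pebbling

variable {m₁ m₂ m₃ r : ℕ} (P : Pebbling (matMulDAG m₁ m₂ m₃) r)

open Finset

open Classical in
/-- The triples `(i, k, j)` whose product `A i k * B k j` has been added to `C i j` in the
state `t`. -/
noncomputable def summed (t : ℕ) : Finset (Fin m₁ × Fin m₂ × Fin m₃) :=
  {p | (.prod p.1 p.2.1 p.2.2, .out p.1 p.2.2) ∈ (P.config t).marked}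

theorem summed_zero : P.summed 0 = ∅ := by
  simp [summed, P.start, initial]

theorem summed_length : P.summed P.length = univ := by
  ext p
  simpa [summed] using P.terminal.2 _ _ (MatMulEdge.out p.1 p.2.1 p.2.2)

theorem card_summed_sdiff_le {s t n k : ℕ} (hst : s ≤ t) (ht : t ≤ P.length)
    (hn : (P.inputs s t).encard ≤ n) (hk : (P.outputs s t).encard ≤ k) :
    (#(P.summed t \ P.summed s) : ℝ) ≤ n * (1 + √k) := by
  have hmarked : ∀ p ∈ P.summed t \ P.summed s,
      (.prod p.1 p.2.1 p.2.2, .out p.1 p.2.2) ∉ (P.config s).marked ∧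
        (.prod p.1 p.2.1 p.2.2, .out p.1 p.2.2) ∈ (P.config t).marked := by
    simp +contextual [summed]
  refine card_triples_le_mul_one_add_sqrt hn hk (fun p hp => ?_) fun p hp => ?_
  · exact (P.mem_inputs_or_source_mem_inputs hst ht (hmarked p hp).1 (hmarked p hp).2).imp_right
      fun h => ⟨h _ (fun _ => nofun) (.left p.1 p.2.1 p.2.2),
        h _ (fun _ => nofun) (.right p.1 p.2.1 p.2.2)⟩
  · exact P.mem_outputs_of_marked (fun _ => nofun) hst ht (hmarked p hp).1 (hmarked p hp).2

theorem card_summed_sdiff_le_mul_sqrt {s t a n : ℕ} (hst : s ≤ t) (ht : t ≤ P.length)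
    (ha : (P.config s).redCount ≤ a) (hcost : P.costUpTo t ≤ P.costUpTo s + n) (hn : n ≤ r)
    (hr : 1 ≤ r) : (#(P.summed t \ P.summed s) : ℝ) ≤ 3 * (a + n : ℕ) * √r := by
  have h := P.card_summed_sdiff_le hst ht (P.encard_union_transferred_le hst ha hcost)
    (P.encard_union_transferred_le hst (P.capacity t ht) hcost)
  have hone : 1 ≤ √(r : ℝ) := Real.one_le_sqrt.2 (by exact_mod_cast hr)
  have hsqrt : √(r + n : ℕ) ≤ 2 * √r := by
    rw [Real.sqrt_le_left (by positivity), mul_pow, Real.sq_sqrt (by positivity)]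
    exact_mod_cast (by lia : r + n ≤ 2 ^ 2 * r)
  calc (#(P.summed t \ P.summed s) : ℝ)
    _ ≤ (a + n : ℕ) * (1 + √(r + n : ℕ)) := h
    _ ≤ (a + n : ℕ) * (3 * √r) := by gcongr; linarith
    _ = 3 * (a + n : ℕ) * √r := by ring

theorem card_summed_le (hr : 1 ≤ r) {t : ℕ} (ht : t ≤ P.length) :
    (#(P.summed t) : ℝ) ≤ 6 * P.costUpTo t * √r := by
  induction t using Nat.strong_induction_on with
  | _ t ih =>
    rcases le_total (P.costUpTo t) r with hcheap | hcostly
    · have h := P.card_summed_sdiff_le_mul_sqrt (a := 0) t.zero_le ht (by simp [P.redCount_zero])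
        (Nat.le_add_left _ _) hcheap hr
      simp only [summed_zero, sdiff_empty, zero_add] at h
      have : 0 ≤ P.costUpTo t * √(r : ℝ) := by positivity
      linarith
    · obtain ⟨s, hst, hs⟩ := P.exists_costUpTo_eq (Nat.sub_le (P.costUpTo t) r)
      have hcost : P.costUpTo t = P.costUpTo s + r := by lia
      have hlt : s < t := hst.lt_of_ne (by rintro rfl; lia)
      have hbefore := ih s hlt (hst.trans ht)
      have hafter := P.card_summed_sdiff_le_mul_sqrt hst ht (P.capacity s (hst.trans ht))
        hcost.le le_rfl hr
      calc (#(P.summed t) : ℝ)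
        _ ≤ #(P.summed t \ P.summed s) + #(P.summed s) := by
            exact_mod_cast card_le_card_sdiff_add_card
        _ ≤ 3 * (r + r : ℕ) * √r + 6 * P.costUpTo s * √r := add_le_add hafter hbefore
        _ = 6 * P.costUpTo t * √r := by rw [hcost]; push_cast; ring

theorem div_sqrt_le_cost (hr : 1 ≤ r) : 1 / 6 * ((m₁ : ℝ) * m₂ * m₃ / √r) ≤ P.cost := by
  have h : (m₁ : ℝ) * m₂ * m₃ ≤ 6 * P.cost * √r := by
    simpa [summed_length, costUpTo_length, mul_assoc] using P.card_summed_le hr le_rfl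
  have hpos : 0 < √(r : ℝ) := Real.sqrt_pos.2 (by exact_mod_cast hr)
  have := (div_le_iff₀ hpos).2 h
  linarith

end PRBP.Pebbling

theorem mainTheorem5 :
    ∃ c : ℝ, 0 < c ∧
      ∀ m₁ m₂ m₃ r : ℕ, 1 ≤ m₁ → 1 ≤ m₂ → 1 ≤ m₃ → 1 ≤ r →
        ENNReal.ofReal (c * ((m₁ : ℝ) * (m₂ : ℝ) * (m₃ : ℝ) / Real.sqrt (r : ℝ))) ≤
          ((PRBP.OPT (matMulDAG m₁ m₂ m₃) r : ℕ∞) : ENNReal) := by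
  refine ⟨1 / 6, by norm_num, fun m₁ m₂ m₃ r _ _ _ hr => ?_⟩
  rw [PRBP.OPT, ENat.toENNReal_iInf]
  refine le_iInf fun P => ?_
  rw [ENat.toENNReal_coe, ← ENNReal.ofReal_natCast]
  exact ENNReal.ofReal_le_ofReal (P.div_sqrt_le_cost hr)
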